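/- \textbf{Theorem.} Let $X$ and $Y$ be separable real Hilbert spaces, let $T : X \to Y$ be continuous, and let $\mu = N(0,K)$ be a centered Gaussian measure on $X$ with covariance operator $K$. Let $K^{1/2}$ be the positive square root of $K$, let $H(\mu) = K^{1/2}X$ be the Cameron--Martin space of $\mu$, and for $u \in H(\mu)$ put $\|u\|_{H(\mu)} = \|K^{-1/2}u\|_X$, where $K^{-1/2}u$ denotes the unique $v \in (\ker K^{1/2})^{\perp}$ with $K^{1/2}v = u$; put $\|u\|_{H(\mu)} = +\infty$ for $u \in X \setminus H(\mu)$. Write $B_r(u)$ for the open ball of radius $r$ centered at $u$ in $X$. Fix a point $y \in T(H(\mu)) \cap \operatorname{supp} T_\sharp\mu$. A point $u^\dagger \in T^{-1}(y)$ is called a \emph{conditional mode} of $\mu(du \mid T(u)=y)$ if $$\lim_{r \downarrow 0} \frac{\mu(B_r(u^\dagger))}{\sup_{u \in T^{-1}(y)} \mu(B_r(u))} = 1 .$$ Then a point $u^y \in X$ is a conditional mode of $\mu(du \mid T(u)=y)$ if and only if it solves the optimization problem $$\operatorname*{minimize}_{u \in X} \ \|u\|_{H(\mu)} \quad \text{subject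 to} \quad T(u) = y,$$ that is, $T(u^y)=y$ and $\|u^y\|_{H(\mu)} \le \|v\|_{H(\mu)}$ for every $v \in X$ with $T(v)=y$. -/

import Mathlib

open MeasureTheory ProbabilityTheory

/-- The positive square root `K^{1/2}` of a positive bounded operator `K` on a real Hilbert space:
the bounded positive (symmetric, nonnegative) operator `S` with `S ∘ S = K`. For positive `K` such
an `S` exists and is unique; the value `0` is only used for operators without such a root. -/
noncomputable def posSqrt {X : Type*} [NormedAddCommGroup X] [InnerProductSpace ℝ X]
    [CompleteSpace X] (K : X →L[ℝ] X) : X →L[ℝ] X :=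
  open Classical in
  if h : ∃ S : X →L[ℝ] X, S.IsPositive ∧ S ∘L S = K then h.choose else 0

/-- The Cameron-Martin space `H(μ) = K^{1/2} X` of a centered Gaussian measure `μ = N(0, K)`.
(For centered `μ` Mathlib's uncentered `covarianceOperator` is the covariance operator.) -/
noncomputable def cameronMartinSpace {X : Type*} [NormedAddCommGroup X] [InnerProductSpace ℝ X]
    [CompleteSpace X] [MeasurableSpace X] [BorelSpace X] (μ : Measure X) : Submodule ℝ X :=
  (posSqrt (covarianceOperator μ)).toLinearMap.range

/-- The Cameron-Martin norm `‖u‖_{H(μ)} = ‖K^{-1/2} u‖` of a centered Gaussian measure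
`μ = N(0, K)`, with values in `[0, ∞]` and equal to `∞` off `H(μ)`. Here `K^{-1/2} u` is the
unique `v ∈ (ker K^{1/2})ᗮ` with `K^{1/2} v = u` (for injective `K`, the unique `v` with
`K^{1/2} v = u`), so the infimum is over a singleton if `u ∈ H(μ)` and over the empty set
otherwise. -/
noncomputable def cameronMartinNorm {X : Type*} [NormedAddCommGroup X] [InnerProductSpace ℝ X]
    [CompleteSpace X] [MeasurableSpace X] [BorelSpace X] (μ : Measure X) (u : X) : ENNReal :=
  ⨅ (v : X) (_ : v ∈ (posSqrt (covarianceOperator μ)).toLinearMap.ker.orthogonal)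
    (_ : posSqrt (covarianceOperator μ) v = u), ‖v‖ₑ

/-- `u` is a conditional mode of `ν(du | T(u) = y)`: `T u = y`, and the ratio of `ν(B_r(u))` to
the supremum of `ν(B_r(v))` over `v ∈ T⁻¹(y)` tends to `1` as `r ↓ 0`. -/
def IsConditionalMode {X Y : Type*} [NormedAddCommGroup X] [MeasurableSpace X]
    (ν : Measure X) (T : X → Y) (y : Y) (u : X) : Prop :=
  u ∈ T ⁻¹' {y} ∧
    Filter.Tendsto
      (fun r : ℝ => ν (Metric.ball u r) / ⨆ v ∈ T ⁻¹' {y}, ν (Metric.ball v r))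
      (nhdsWithin 0 (Set.Ioi 0)) (nhds 1)

/-- `u` solves `minimize ‖u‖_{H(μ)} over u ∈ X subject to T(u) = y`. -/
def SolvesConstrainedMinimization {X Y : Type*} [NormedAddCommGroup X] [InnerProductSpace ℝ X]
    [CompleteSpace X] [MeasurableSpace X] [BorelSpace X] (μ : Measure X) (T : X → Y) (y : Y)
    (u : X) : Prop :=
  u ∈ T ⁻¹' {y} ∧ ∀ v ∈ T ⁻¹' {y}, cameronMartinNorm μ u ≤ cameronMartinNorm μ v

/-! Write S for the square root of K. The proof rests on two comparisons of small balls with the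
ball at the origin. From below (`exp_mul_measure_ball_zero_le_ball_posSqrt`): for h orthogonal to
ker S, the ball B_r(S h) has at least exp(-‖h‖²/2) times the mass of B_r(0), by the Cameron-Martin
formula and the symmetry of μ. From above (`exists_tendsto_posSqrt_of_eventually_le`): if centers
u_r, which may move with r, carry at least exp(-κ/2) times the mass of B_r(0), then along any
ultrafilter of radii r ↓ 0 they converge to some S h₀ with ‖h₀‖² ≤ κ. This combines the
Cameron-Martin formula, Anderson's inequality and the compactness of K.

If u is a mode, every feasible S h bounds the supremum from below, hence almost bounds the mass at u
from below; the second comparison with constant centers bounds the norm of u. Conversely, if a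
minimizer is not a mode, then along some radii r ↓ 0 other feasible centers carry more mass by a
fixed factor. They accumulate at a point that is feasible, since T⁻¹(y) is closed, and has strictly
smaller norm: a contradiction. -/

/-! ### Polynomial approximation of the square root -/

open Polynomial in
/-- A polynomial with nonnegative coefficients, evaluated at an element of norm at most one, is
bounded by its value at `1`. -/
theorem norm_aeval_le_eval_one {A : Type*} [NormedRing A] [NormedAlgebra ℝ A] {T : A}
    (h1 : ‖(1 : A)‖ ≤ 1) (hT : ‖T‖ ≤ 1) {q : ℝ[X]} (hq : ∀ i, 0 ≤ q.coeff i) :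
    ‖aeval T q‖ ≤ q.eval 1 := by
  rw [aeval_eq_sum_range, eval_eq_sum_range]
  refine (norm_sum_le _ _).trans (Finset.sum_le_sum fun i _ ↦ ?_)
  have hpow : ‖T ^ i‖ ≤ 1 := by
    rcases i.eq_zero_or_pos with rfl | hi
    · simpa using h1
    · exact (norm_pow_le' T hi).trans (pow_le_one₀ (norm_nonneg _) hT)
  rw [norm_smul, Real.norm_of_nonneg (hq i), one_pow]
  exact mul_le_mul_of_nonneg_left hpow (hq i)

open Polynomial in
theorem coeff_mul_nonneg {p q : ℝ[X]} (hp : ∀ i, 0 ≤ p.coeff i) (hq : ∀ i, 0 ≤ q.coeff i)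
    (i : ℕ) : 0 ≤ (p * q).coeff i := by
  rw [coeff_mul]
  exact Finset.sum_nonneg fun _ _ ↦ mul_nonneg (hp _) (hq _)

open Polynomial in
/-- Polynomial iterates converging to `1 - √(1 - X)`. -/
noncomputable def sqrtIterate : ℕ → ℝ[X]
  | 0 => 0
  | n + 1 => C (1 / 2) * (X + sqrtIterate n ^ 2)

open Polynomial in
theorem coeff_sqrtIterate_nonneg (n i : ℕ) : 0 ≤ (sqrtIterate n).coeff i := by
  induction n generalizing i with
  | zero => simp [sqrtIterate]
  | succ n ih =>
    rw [sqrtIterate, coeff_C_mul, coeff_add, coeff_X, sq]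
    have := coeff_mul_nonneg ih ih i
    split_ifs <;> linarith

-- Successive differences factor as half of (p - q)(p + q), so nonnegativity propagates by
-- induction.
open Polynomial in
theorem coeff_sqrtIterate_succ_sub_nonneg (n i : ℕ) :
    0 ≤ (sqrtIterate (n + 1) - sqrtIterate n).coeff i := by
  induction n generalizing i with
  | zero => simpa [sqrtIterate] using coeff_sqrtIterate_nonneg 1 i
  | succ n ih =>
    have h : sqrtIterate (n + 2) - sqrtIterate (n + 1) =
        C (1 / 2) * ((sqrtIterate (n + 1) - sqrtIterate n) *
          (sqrtIterate (n + 1) + sqrtIterate n)) := by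
      rw [sqrtIterate, show sqrtIterate (n + 1) = C (1 / 2) * (X + sqrtIterate n ^ 2) from rfl]
      ring
    rw [h, coeff_C_mul]
    refine mul_nonneg (by norm_num) (coeff_mul_nonneg ih (fun j ↦ ?_) i)
    rw [coeff_add]
    exact add_nonneg (coeff_sqrtIterate_nonneg _ _) (coeff_sqrtIterate_nonneg _ _)

open Polynomial in
theorem coeff_sqrtIterate_sub_nonneg {m n : ℕ} (h : m ≤ n) (i : ℕ) :
    0 ≤ (sqrtIterate n - sqrtIterate m).coeff i := by
  induction n, h using Nat.le_induction with
  | base => simp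
  | succ n _ ih =>
    have := coeff_sqrtIterate_succ_sub_nonneg n i
    rw [coeff_sub] at *
    linarith

theorem eval_one_sqrtIterate_mem (n : ℕ) : (sqrtIterate n).eval 1 ∈ Set.Icc (0 : ℝ) 1 := by
  induction n with
  | zero => simp [sqrtIterate]
  | succ n ih =>
    obtain ⟨h0, h1⟩ := ih
    simp only [sqrtIterate, Polynomial.eval_mul, Polynomial.eval_C, Polynomial.eval_add,
      Polynomial.eval_X, Polynomial.eval_pow]
    constructor <;> nlinarith

-- Differences of iterates have nonnegative coefficients, so their norms at T are dominated by the
-- increments at 1 of a bounded monotone real sequence.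
open Polynomial in
theorem cauchySeq_aeval_sqrtIterate {A : Type*} [NormedRing A] [NormedAlgebra ℝ A] {T : A}
    (h1 : ‖(1 : A)‖ ≤ 1) (hT : ‖T‖ ≤ 1) : CauchySeq fun n ↦ aeval T (sqrtIterate n) := by
  have hmono : Monotone fun n ↦ (sqrtIterate n).eval 1 := by
    intro m n h
    -- Only the sign is needed: a quantity that bounds a norm is nonnegative.
    have := norm_aeval_le_eval_one (A := ℝ) (T := 1) (by simp) (by simp)
      (coeff_sqrtIterate_sub_nonneg h)
    have := (norm_nonneg _).trans this
    rw [eval_sub] at this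
    exact sub_nonneg.1 this
  have hc : CauchySeq fun n ↦ (sqrtIterate n).eval 1 :=
    (tendsto_atTop_ciSup hmono
      ⟨1, by rintro _ ⟨n, rfl⟩; exact (eval_one_sqrtIterate_mem n).2⟩).cauchySeq
  rw [Metric.cauchySeq_iff'] at hc ⊢
  intro ε hε
  obtain ⟨N, hN⟩ := hc ε hε
  refine ⟨N, fun n hn ↦ lt_of_le_of_lt ?_ (hN n hn)⟩
  rw [dist_eq_norm, dist_eq_norm, ← map_sub]
  refine (norm_aeval_le_eval_one h1 hT (coeff_sqrtIterate_sub_nonneg hn)).trans ?_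
  rw [eval_sub]
  exact le_abs_self _

/-! ### Existence of positive square roots -/

section

variable {X : Type*} [NormedAddCommGroup X] [InnerProductSpace ℝ X] [CompleteSpace X]

open scoped RealInnerProductSpace

omit [CompleteSpace X] in
theorem ContinuousLinearMap.IsPositive.inner_sq_le {T : X →L[ℝ] X} (hT : T.IsPositive) (x y : X) :
    ⟪T x, y⟫ ^ 2 ≤ ⟪T x, x⟫ * ⟪T y, y⟫ := by
  have h : ∀ t : ℝ, 0 ≤ ⟪T y, y⟫ * (t * t) + 2 * ⟪T x, y⟫ * t + ⟪T x, x⟫ := by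
    intro t
    have := hT.inner_nonneg_left (x + t • y)
    have hs : ⟪T y, x⟫ = ⟪T x, y⟫ := by
      rw [hT.inner_left_eq_inner_right, real_inner_comm]
    simp only [map_add, map_smul, inner_add_left, inner_add_right, real_inner_smul_left,
      real_inner_smul_right, hs] at this
    linarith
  have := discrim_le_zero h
  rw [discrim] at this
  nlinarith

omit [CompleteSpace X] in
theorem ContinuousLinearMap.IsPositive.norm_le_one {T : X →L[ℝ] X} (hT : T.IsPositive)
    (h : ∀ x, ⟪T x, x⟫ ≤ ‖x‖ ^ 2) : ‖T‖ ≤ 1 := by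
  refine T.opNorm_le_bound zero_le_one fun x ↦ ?_
  have h1 := hT.inner_sq_le x (T x)
  rw [real_inner_self_eq_norm_sq] at h1
  have h2 : (‖T x‖ ^ 2) ^ 2 ≤ ‖x‖ ^ 2 * ‖T x‖ ^ 2 :=
    h1.trans (mul_le_mul (h x) (h _) (hT.inner_nonneg_left _) (by positivity))
  rw [one_mul]
  by_contra! hlt
  have h0 : 0 < ‖T x‖ := (norm_nonneg _).trans_lt hlt
  have h3 : ‖x‖ ^ 2 < ‖T x‖ ^ 2 := by gcongr
  nlinarith [pow_pos h0 2]

/-- The limit Y of the iterates solves 2Y = T + Y², that is (1 - Y)² = 1 - T, and ‖Y‖ ≤ 1 makes 1 -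
Y positive. -/
theorem exists_isPositive_comp_self_eq_one_sub {T : X →L[ℝ] X} (hT : IsSelfAdjoint T)
    (h : ‖T‖ ≤ 1) : ∃ S : X →L[ℝ] X, S.IsPositive ∧ S ∘L S = 1 - T := by
  have h1 : ‖(1 : X →L[ℝ] X)‖ ≤ 1 := ContinuousLinearMap.norm_id_le
  obtain ⟨Y, hY⟩ := cauchySeq_tendsto_of_complete (cauchySeq_aeval_sqrtIterate h1 h)
  have hfix : Y = (1 / 2 : ℝ) • (T + Y ^ 2) := by
    refine tendsto_nhds_unique (hY.comp (Filter.tendsto_add_atTop_nat 1)) ?_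
    have : ((fun n ↦ Polynomial.aeval T (sqrtIterate n)) ∘ fun n ↦ n + 1) =
        fun n ↦ (1 / 2 : ℝ) • (T + Polynomial.aeval T (sqrtIterate n) ^ 2) := by
      ext1 n
      simp [sqrtIterate, Algebra.smul_def]
    rw [this]
    exact ((hY.pow 2).const_add T).const_smul _
  have hsa : IsSelfAdjoint Y := by
    have hn : ∀ n, IsSelfAdjoint (Polynomial.aeval T (sqrtIterate n)) := by
      intro n
      induction n with
      | zero => simp [sqrtIterate]
      | succ n ih =>
        have : Polynomial.aeval T (sqrtIterate (n + 1)) =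
            (1 / 2 : ℝ) • (T + Polynomial.aeval T (sqrtIterate n) ^ 2) := by
          simp [sqrtIterate, Algebra.smul_def]
        rw [this]
        exact IsSelfAdjoint.smul (IsSelfAdjoint.all _) (hT.add (ih.pow 2))
    exact (isClosed_eq continuous_star continuous_id).mem_of_tendsto hY
      (Filter.Eventually.of_forall hn)
  have hnorm : ‖Y‖ ≤ 1 := le_of_tendsto hY.norm <| Filter.Eventually.of_forall fun n ↦
    (norm_aeval_le_eval_one h1 h (coeff_sqrtIterate_nonneg n)).trans (eval_one_sqrtIterate_mem n).2
  refine ⟨1 - Y, ?_, ?_⟩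
  · rw [ContinuousLinearMap.isPositive_def']
    refine ⟨(IsSelfAdjoint.one _).sub hsa, fun x ↦ ?_⟩
    have h2 : ⟪Y x, x⟫ ≤ ‖x‖ * ‖x‖ := (real_inner_le_norm _ _).trans <|
      mul_le_mul_of_nonneg_right (Y.le_of_opNorm_le hnorm x |>.trans_eq (one_mul _))
        (norm_nonneg _)
    simp only [ContinuousLinearMap.reApplyInnerSelf, sub_apply, inner_sub_left,
      one_apply_eq_self, real_inner_self_eq_norm_mul_norm, RCLike.re_to_real]
    linarith
  · change (1 - Y) * (1 - Y) = 1 - T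
    have h3 : (2 : ℝ) • Y = T + Y ^ 2 := by
      conv_lhs => rw [hfix]
      rw [smul_smul]; norm_num
    rw [two_smul] at h3
    have : (1 - Y) * (1 - Y) = 1 - (Y + Y) + Y ^ 2 := by noncomm_ring
    rw [this, h3]
    abel

/-- After division by ‖K‖ the operator has the form 1 - T with 0 ≤ T ≤ 1. -/
theorem ContinuousLinearMap.IsPositive.exists_comp_self_eq {K : X →L[ℝ] X} (hK : K.IsPositive) :
    ∃ S : X →L[ℝ] X, S.IsPositive ∧ S ∘L S = K := by
  rcases eq_or_ne K 0 with rfl | hne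
  · exact ⟨0, ContinuousLinearMap.isPositive_zero, by simp⟩
  have hpos : 0 < ‖K‖ := norm_pos_iff.2 hne
  have hle : ∀ x, ⟪K x, x⟫ ≤ ‖K‖ * ‖x‖ ^ 2 := fun x ↦ by
    refine (real_inner_le_norm _ _).trans ?_
    rw [sq, ← mul_assoc]
    exact mul_le_mul_of_nonneg_right (K.le_opNorm x) (norm_nonneg _)
  have hT : (1 - ‖K‖⁻¹ • K).IsPositive := by
    rw [ContinuousLinearMap.isPositive_def']
    refine ⟨(IsSelfAdjoint.one _).sub (IsSelfAdjoint.smul (IsSelfAdjoint.all _) hK.isSelfAdjoint),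
      fun x ↦ ?_⟩
    have := mul_le_mul_of_nonneg_left (hle x) (inv_nonneg.2 hpos.le)
    rw [← mul_assoc, inv_mul_cancel₀ hpos.ne', one_mul] at this
    simpa [ContinuousLinearMap.reApplyInnerSelf, inner_sub_left, real_inner_smul_left] using this
  have hT1 : ‖1 - ‖K‖⁻¹ • K‖ ≤ 1 := hT.norm_le_one fun x ↦ by
    have := mul_nonneg (inv_nonneg.2 hpos.le) (hK.inner_nonneg_left x)
    simpa [inner_sub_left, real_inner_smul_left] using this
  obtain ⟨S, hS, hSS⟩ := exists_isPositive_comp_self_eq_one_sub hT.isSelfAdjoint hT1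
  refine ⟨√‖K‖ • S, hS.smul_of_nonneg (Real.sqrt_nonneg _), ?_⟩
  rw [ContinuousLinearMap.smul_comp, ContinuousLinearMap.comp_smul, hSS, smul_smul,
    Real.mul_self_sqrt hpos.le, sub_sub_cancel, smul_smul, mul_inv_cancel₀ hpos.ne', one_smul]

theorem posSqrt_spec {K : X →L[ℝ] X} (hK : K.IsPositive) :
    (posSqrt K).IsPositive ∧ posSqrt K ∘L posSqrt K = K := by
  rw [posSqrt, dif_pos hK.exists_comp_self_eq]
  exact hK.exists_comp_self_eq.choose_spec

end

/-! ### Gaussian measures on the line -/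

section

open scoped RealInnerProductSpace NNReal ENNReal

/-- Bathtub principle: A \ B and B \ A have equal mass, and θ separates the values of f on them. -/
theorem setLIntegral_le_of_measure_eq {α : Type*} {mα : MeasurableSpace α} {ν : Measure α}
    {A B : Set α} (hA : MeasurableSet A) (hB : MeasurableSet B) (hAB : ν A = ν B) (hfin : ν B ≠ ∞)
    {f : α → ℝ≥0∞} (θ : ℝ≥0∞) (h1 : ∀ x ∈ A \ B, f x ≤ θ) (h2 : ∀ x ∈ B \ A, θ ≤ f x) :
    ∫⁻ x in A, f x ∂ν ≤ ∫⁻ x in B, f x ∂ν := by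
  rw [← lintegral_inter_add_sdiff f A hB, ← lintegral_inter_add_sdiff f B hA, Set.inter_comm B A]
  refine add_le_add_right ?_ _
  have hd : ν (A \ B) = ν (B \ A) := by
    rw [measure_sdiff' A hB.nullMeasurableSet hfin,
      measure_sdiff' B hA.nullMeasurableSet (hAB ▸ hfin), hAB, Set.union_comm]
  calc ∫⁻ x in A \ B, f x ∂ν ≤ ∫⁻ _ in A \ B, θ ∂ν := setLIntegral_mono measurable_const h1
    _ = ∫⁻ _ in B \ A, θ ∂ν := by simp [hd]
    _ ≤ ∫⁻ x in B \ A, f x ∂ν := setLIntegral_mono' (hB.diff hA) h2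

/-- Anderson's inequality for the centered Gaussian distribution on the line. -/
theorem gaussianReal_zero_translate_le (v : ℝ≥0) (c d : ℝ) :
    gaussianReal 0 v {s | (s - c) ^ 2 ≤ d} ≤ gaussianReal 0 v {s | s ^ 2 ≤ d} := by
  have hA : MeasurableSet {s : ℝ | (s - c) ^ 2 ≤ d} := measurableSet_le (by fun_prop) (by fun_prop)
  have hB : MeasurableSet {s : ℝ | s ^ 2 ≤ d} := measurableSet_le (by fun_prop) (by fun_prop)
  rcases eq_or_ne v 0 with rfl | hv
  · rw [gaussianReal_zero_var, Measure.dirac_apply' _ hA, Measure.dirac_apply' _ hB]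
    by_cases h : (0 : ℝ) ∈ {s : ℝ | (s - c) ^ 2 ≤ d}
    · have h0 : (0 : ℝ) ∈ {s : ℝ | s ^ 2 ≤ d} := by
        simp only [Set.mem_ofPred_eq, zero_sub, even_two, Even.neg_pow] at h ⊢
        nlinarith [sq_nonneg c]
      simp only [Set.indicator_of_mem h0, Set.indicator_of_mem h, le_refl]
    · simp [Set.indicator_of_notMem h]
  rw [gaussianReal_apply _ hv, gaussianReal_apply _ hv]
  have hset : {s : ℝ | (s - c) ^ 2 ≤ d} = (fun s ↦ s + (-c)) ⁻¹' {s | s ^ 2 ≤ d} := by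
    ext s; simp [sub_eq_add_neg]
  have hfin : volume {s : ℝ | s ^ 2 ≤ d} ≠ ∞ := by
    refine ((measure_mono (t := Set.Icc (-√d) √d) fun s hs ↦ ?_).trans_lt measure_Icc_lt_top).ne
    exact abs_le.1 (Real.abs_le_sqrt hs)
  -- The threshold is the value of the density where s² = d.
  refine setLIntegral_le_of_measure_eq hA hB (by rw [hset, measure_preimage_add_right]) hfin
    (ENNReal.ofReal ((√(2 * Real.pi * v))⁻¹ * Real.exp (-d / (2 * v)))) ?_ ?_
  · rintro s ⟨-, hs⟩
    have hs : d ≤ s ^ 2 := (not_le.1 hs).le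
    rw [gaussianPDF, gaussianPDFReal, sub_zero]
    gcongr
  · rintro s ⟨hs, -⟩
    have hs : s ^ 2 ≤ d := hs
    rw [gaussianPDF, gaussianPDFReal, sub_zero]
    gcongr

/-- The Cameron-Martin formula on the line. -/
theorem lintegral_gaussianReal_sub (v : ℝ≥0) {g : ℝ → ℝ≥0∞} (hg : Measurable g) :
    ∫⁻ s, g (s - v) ∂gaussianReal 0 v =
      ∫⁻ s, g s * ENNReal.ofReal (Real.exp (-s - v / 2)) ∂gaussianReal 0 v := by
  rcases eq_or_ne v 0 with rfl | hv
  · simp [gaussianReal_zero_var]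
  have hv' : (v : ℝ) ≠ 0 := by exact_mod_cast hv
  rw [← lintegral_map (f := g) (μ := gaussianReal 0 v) (g := fun s ↦ s - v) hg (by fun_prop),
    gaussianReal_map_sub_const, gaussianReal_of_var_ne_zero _ hv, gaussianReal_of_var_ne_zero _ hv,
    lintegral_withDensity_eq_lintegral_mul _ (measurable_gaussianPDF _ _) hg,
    lintegral_withDensity_eq_lintegral_mul _ (measurable_gaussianPDF _ _) (by fun_prop)]
  refine lintegral_congr fun s ↦ ?_
  simp only [Pi.mul_apply]
  rw [mul_comm (g s), ← mul_assoc]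
  congr 1
  rw [gaussianPDF, gaussianPDF, ← ENNReal.ofReal_mul (gaussianPDFReal_nonneg _ _ _)]
  congr 1
  rw [gaussianPDFReal, gaussianPDFReal, mul_assoc (_ : ℝ)⁻¹, ← Real.exp_add]
  congr 2
  field_simp
  ring

/-! ### Splitting off one direction and the Cameron-Martin formula -/

variable {X : Type*} [NormedAddCommGroup X] [InnerProductSpace ℝ X] [CompleteSpace X]
  [TopologicalSpace.SeparableSpace X] [MeasurableSpace X] [BorelSpace X]
  {μ : Measure X} [IsGaussian μ]

omit [TopologicalSpace.SeparableSpace X] in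
theorem covarianceOperator_isPositive (μ : Measure X) : (covarianceOperator μ).IsPositive :=
  isPositive_covarianceOperator

theorem integral_inner_eq_zero (hμ : ∫ x, x ∂μ = 0) (a : X) : ∫ x, ⟪a, x⟫ ∂μ = 0 := by
  have : SecondCountableTopology X := UniformSpace.secondCountable_of_separable X
  have := IsGaussian.integral_dual (μ := μ) (innerSL ℝ a)
  simpa [hμ] using this

theorem covarianceOperator_inner_of_isGaussian (a b : X) :
    ⟪covarianceOperator μ a, b⟫ = ∫ x, ⟪a, x⟫ * ⟪b, x⟫ ∂μ := by
  have : SecondCountableTopology X := UniformSpace.secondCountable_of_separable X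
  exact covarianceOperator_inner IsGaussian.memLp_two_id a b

theorem covariance_inner_eq (hμ : ∫ x, x ∂μ = 0) (a b : X) :
    cov[fun x ↦ ⟪a, x⟫, fun x ↦ ⟪b, x⟫; μ] = ⟪covarianceOperator μ a, b⟫ := by
  rw [covariance, integral_inner_eq_zero hμ, integral_inner_eq_zero hμ,
    covarianceOperator_inner_of_isGaussian]
  simp

theorem map_inner_eq_gaussianReal (hμ : ∫ x, x ∂μ = 0) (a : X) :
    μ.map (fun x ↦ ⟪a, x⟫) = gaussianReal 0 ⟪covarianceOperator μ a, a⟫.toNNReal := by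
  have h := (IsGaussian.hasGaussianLaw_id (μ := μ)).map_fun (innerSL ℝ a)
  have h2 := h.map_eq_gaussianReal
  simp only [id, innerSL_apply_apply] at h2
  rw [h2, integral_inner_eq_zero hμ, ← covariance_inner_eq hμ, covariance_self (by fun_prop)]

theorem map_neg_eq_self (hμ : ∫ x, x ∂μ = 0) : μ.map (fun x ↦ -x) = μ := by
  refine Measure.ext_of_charFun (funext fun t ↦ ?_)
  have h1 : (fun x : X ↦ ⟪t, -x⟫) = -(fun x ↦ ⟪t, x⟫) := by ext; simp
  rw [IsGaussian.charFun_eq, IsGaussian.charFun_eq, integral_complex_ofReal,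
    integral_complex_ofReal, integral_map (by fun_prop) (by fun_prop),
    variance_map (by fun_prop) (by fun_prop)]
  simp only [Function.comp_def]
  rw [variance_congr (Filter.EventuallyEq.of_eq h1), variance_neg, integral_inner_eq_zero hμ]
  simp [inner_neg_right, integral_neg, integral_inner_eq_zero hμ]

/-- The part `x - ⟪a, x⟫ k` of a centered Gaussian vector is independent of `⟪a, x⟫` if
`K a` is a multiple of `k` and `⟪a, k⟫ = 1`. -/
theorem eq_map_prod_of_covarianceOperator_apply_eq (hμ : ∫ x, x ∂μ = 0) {a k : X} {c : ℝ}
    (hak : ⟪a, k⟫ = 1) (hK : covarianceOperator μ a = c • k) :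
    μ = ((gaussianReal 0 ⟪covarianceOperator μ a, a⟫.toNNReal).prod
      (μ.map fun x ↦ x - ⟪a, x⟫ • k)).map fun p ↦ p.1 • k + p.2 := by
  have : SecondCountableTopology X := UniformSpace.secondCountable_of_separable X
  have hpair : HasGaussianLaw (fun x ↦ (⟪a, x⟫, x - ⟪a, x⟫ • k)) μ :=
    (IsGaussian.hasGaussianLaw_id (μ := μ)).map_fun
      ((innerSL ℝ a).prod (ContinuousLinearMap.id ℝ X - (innerSL ℝ a).smulRight k))
  have hind : IndepFun (fun x ↦ ⟪a, x⟫) (fun x ↦ x - ⟪a, x⟫ • k) μ := by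
    refine hpair.indepFun_of_covariance_inner fun t b ↦ ?_
    have h1 : (fun x ↦ ⟪t, ⟪a, x⟫⟫) = fun x ↦ ⟪t • a, x⟫ := by
      ext x; simp [real_inner_smul_left, mul_comm]
    have h2 : (fun x ↦ ⟪b, x - ⟪a, x⟫ • k⟫) = fun x ↦ ⟪b - ⟪b, k⟫ • a, x⟫ := by
      ext x
      simp only [inner_sub_right, inner_sub_left, real_inner_smul_left, real_inner_smul_right]
      ring
    rw [h1, h2, covariance_inner_eq hμ, map_smul, hK]
    simp only [inner_sub_right, real_inner_smul_left, real_inner_smul_right,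
      real_inner_comm a k, hak, real_inner_comm k b]
    ring
  rw [← map_inner_eq_gaussianReal hμ, ← hind.map_prod_eq_prod_map_map (by fun_prop) (by fun_prop),
    Measure.map_map (by fun_prop) (by fun_prop)]
  simp [Function.comp_def]

theorem lintegral_eq_lintegral_prod (hμ : ∫ x, x ∂μ = 0) {a k : X} {c : ℝ}
    (hak : ⟪a, k⟫ = 1) (hK : covarianceOperator μ a = c • k) {f : X → ℝ≥0∞} (hf : Measurable f) :
    ∫⁻ x, f x ∂μ = ∫⁻ x, ∫⁻ s, f (s • k + (x - ⟪a, x⟫ • k))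
      ∂gaussianReal 0 ⟪covarianceOperator μ a, a⟫.toNNReal ∂μ := by
  have : SecondCountableTopology X := UniformSpace.secondCountable_of_separable X
  have : IsProbabilityMeasure (μ.map fun x ↦ x - ⟪a, x⟫ • k) :=
    Measure.isProbabilityMeasure_map (by fun_prop)
  conv_lhs => rw [eq_map_prod_of_covarianceOperator_apply_eq hμ hak hK]
  rw [lintegral_map hf (by fun_prop), lintegral_prod_symm _ (by fun_prop),
    lintegral_map (Measurable.lintegral_prod_left'
      (f := fun p : ℝ × X ↦ f (p.1 • k + p.2)) (by fun_prop)) (by fun_prop)]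

theorem inner_ae_eq_zero_of_inner_covarianceOperator_eq_zero (hμ : ∫ x, x ∂μ = 0) {a : X}
    (h : ⟪covarianceOperator μ a, a⟫ = 0) : ∀ᵐ x ∂μ, ⟪a, x⟫ = 0 := by
  have h1 := map_inner_eq_gaussianReal hμ a
  rw [h, Real.toNNReal_zero, gaussianReal_zero_var] at h1
  have h2 : ∀ᵐ s ∂μ.map (fun x ↦ ⟪a, x⟫), s = 0 := by rw [h1]; simp [ae_dirac_eq]
  exact ae_of_ae_map (by fun_prop) h2

/-- The **Cameron-Martin formula** for shifts by elements of the range of the covariance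
operator. -/
theorem lintegral_sub_covarianceOperator (hμ : ∫ x, x ∂μ = 0) (a : X) {f : X → ℝ≥0∞}
    (hf : Measurable f) :
    ∫⁻ x, f (x - covarianceOperator μ a) ∂μ =
      ∫⁻ x, f x * ENNReal.ofReal (Real.exp (-⟪a, x⟫ - ⟪covarianceOperator μ a, a⟫ / 2)) ∂μ := by
  have : SecondCountableTopology X := UniformSpace.secondCountable_of_separable X
  have hpos := covarianceOperator_isPositive μ
  set K := covarianceOperator μ with hKdef
  rcases (hpos.inner_nonneg_left a).eq_or_lt with h0 | h0
  · have hKa : K a = 0 := by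
      have := hpos.inner_sq_le a (K a)
      rw [← h0, zero_mul, real_inner_self_eq_norm_sq] at this
      have h4 : ‖K a‖ ^ 2 = 0 := by nlinarith [sq_nonneg (‖K a‖ ^ 2)]
      simpa using h4
    refine lintegral_congr_ae ?_
    filter_upwards [inner_ae_eq_zero_of_inner_covarianceOperator_eq_zero hμ h0.symm] with x hx
    simp [hKa, hx]
  · set v := ⟪K a, a⟫ with hv
    -- In the direction k = v⁻¹ K a, the shift by K a moves the line coordinate by its variance v
    -- and fixes the independent remainder.
    have hak : ⟪a, v⁻¹ • K a⟫ = 1 := by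
      rw [real_inner_smul_right, real_inner_comm, ← hv, inv_mul_cancel₀ h0.ne']
    have hK : K a = v • (v⁻¹ • K a) := by rw [smul_smul, mul_inv_cancel₀ h0.ne', one_smul]
    rw [lintegral_eq_lintegral_prod hμ hak hK (f := fun x ↦ f (x - K a)) (by fun_prop),
      lintegral_eq_lintegral_prod hμ hak hK
        (f := fun x ↦ f x * ENNReal.ofReal (Real.exp (-⟪a, x⟫ - v / 2))) (by fun_prop)]
    refine lintegral_congr fun x ↦ ?_
    have h1 := lintegral_gaussianReal_sub v.toNNReal
      (g := fun s ↦ f (s • (v⁻¹ • K a) + (x - ⟪a, x⟫ • (v⁻¹ • K a)))) (by fun_prop)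
    rw [Real.coe_toNNReal _ h0.le] at h1
    have h2 : ∀ s : ℝ, s • v⁻¹ • K a + (x - ⟪a, x⟫ • v⁻¹ • K a) - K a =
        (s - v) • (v⁻¹ • K a) + (x - ⟪a, x⟫ • (v⁻¹ • K a)) := fun s ↦ by
      rw [sub_smul, ← hK]; abel
    have h3 : ∀ s : ℝ, ⟪a, s • v⁻¹ • K a + (x - ⟪a, x⟫ • v⁻¹ • K a)⟫ = s := fun s ↦ by
      rw [inner_add_right, inner_sub_right, real_inner_smul_right, real_inner_smul_right _ _ ⟪a, x⟫,
        hak]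
      ring
    simp only [h2, h3]
    exact h1

/-- On the shifted ball, ⟪a, x⟫ differs from its value at the center by at most ‖a‖ r, which bounds
the Cameron-Martin density. -/
theorem measure_ball_le_exp_mul_ball_sub (hμ : ∫ x, x ∂μ = 0) (u a : X) (r : ℝ) :
    μ (Metric.ball u r) ≤
      ENNReal.ofReal (Real.exp (⟪covarianceOperator μ a, a⟫ / 2 - ⟪a, u⟫ + ‖a‖ * r)) *
        μ (Metric.ball (u - covarianceOperator μ a) r) := by
  set K := covarianceOperator μ
  have hB := (Metric.isOpen_ball (x := u - K a) (ε := r)).measurableSet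
  have h1 : ∀ x, (Metric.ball u r).indicator (1 : X → ℝ≥0∞) x =
      (Metric.ball (u - K a) r).indicator 1 (x - K a) := fun x ↦ by
    simp [Set.indicator, Metric.mem_ball, dist_eq_norm]
  rw [← lintegral_indicator_one Metric.isOpen_ball.measurableSet, lintegral_congr h1,
    lintegral_sub_covarianceOperator hμ a (measurable_one.indicator hB),
    ← lintegral_indicator_one hB, ← lintegral_const_mul _ (measurable_one.indicator hB)]
  refine lintegral_mono fun x ↦ ?_
  by_cases hx : x ∈ Metric.ball (u - K a) r
  · simp only [Set.indicator_of_mem hx, Pi.one_apply, one_mul, mul_one]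
    gcongr
    have h2 : ⟪a, u - K a - x⟫ ≤ ‖a‖ * r := (real_inner_le_norm _ _).trans <| by
      gcongr
      rw [← dist_eq_norm, dist_comm]
      exact (Metric.mem_ball.1 hx).le
    rw [inner_sub_right, inner_sub_right, real_inner_comm (K a) a] at h2
    rw [show ⟪K a, a⟫ = ⟪a, K a⟫ from real_inner_comm _ _] at *
    linarith
  · simp [Set.indicator_of_notMem hx]

/-- By symmetry the balls at ±K a have equal mass; averaging their densities turns exp(-⟪a, x⟫) into
cosh ⟪a, x⟫ ≥ 1. -/
theorem exp_mul_measure_ball_zero_le (hμ : ∫ x, x ∂μ = 0) (a : X) (r : ℝ) :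
    ENNReal.ofReal (Real.exp (-(⟪covarianceOperator μ a, a⟫ / 2))) * μ (Metric.ball 0 r) ≤
      μ (Metric.ball (covarianceOperator μ a) r) := by
  have hB := (Metric.isOpen_ball (x := (0 : X)) (ε := r)).measurableSet
  set K := covarianceOperator μ with hKdef
  have key : ∀ b : X, μ (Metric.ball (K b) r) = ∫⁻ x, (Metric.ball 0 r).indicator 1 x *
      ENNReal.ofReal (Real.exp (-⟪b, x⟫ - ⟪K b, b⟫ / 2)) ∂μ := fun b ↦ by
    rw [← lintegral_sub_covarianceOperator hμ b (measurable_one.indicator hB),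
      ← lintegral_indicator_one Metric.isOpen_ball.measurableSet]
    refine lintegral_congr fun x ↦ ?_
    simp [Set.indicator, Metric.mem_ball, dist_eq_norm, hKdef]
  have hsymm : μ (Metric.ball (K (-a)) r) = μ (Metric.ball (K a) r) := by
    conv_lhs => rw [← map_neg_eq_self hμ]
    rw [Measure.map_apply (by fun_prop) Metric.isOpen_ball.measurableSet]
    congr 1
    ext x
    simp only [Set.mem_preimage, Metric.mem_ball, map_neg, dist_neg_neg]
  have h2 : 2 * (ENNReal.ofReal (Real.exp (-(⟪K a, a⟫ / 2))) * μ (Metric.ball 0 r)) ≤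
      2 * μ (Metric.ball (K a) r) := by
    rw [two_mul (μ _)]
    nth_rewrite 1 [← hsymm]
    rw [key, key, ← lintegral_add_left (by fun_prop), ← lintegral_indicator_one hB, ← mul_assoc,
      ← lintegral_const_mul _ (measurable_one.indicator hB)]
    refine lintegral_mono fun x ↦ ?_
    by_cases hx : x ∈ Metric.ball (0 : X) r
    · simp only [Set.indicator_of_mem hx, Pi.one_apply, one_mul, mul_one, map_neg, inner_neg_left,
        inner_neg_right, neg_neg]
      rw [← ENNReal.ofReal_add (Real.exp_nonneg _) (Real.exp_nonneg _),
        show (2 : ℝ≥0∞) = ENNReal.ofReal 2 by simp, ← ENNReal.ofReal_mul zero_le_two]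
      gcongr
      have hc := Real.one_le_cosh ⟪a, x⟫
      rw [Real.cosh_eq] at hc
      rw [sub_eq_add_neg, sub_eq_add_neg, Real.exp_add, Real.exp_add, ← add_mul]
      exact mul_le_mul_of_nonneg_right (by linarith) (Real.exp_nonneg _)
    · simp [Set.indicator_of_notMem hx]
  exact (ENNReal.mul_le_mul_iff_right two_ne_zero ENNReal.ofNat_ne_top).1 h2

end

/-! ### Weak compactness and compactness of the covariance -/

section

open scoped RealInnerProductSpace NNReal ENNReal Topology
open Filter

/-- Weak sequential compactness of bounded sets, for ultrafilters. -/
theorem exists_tendsto_inner_of_norm_le {X : Type*} [NormedAddCommGroup X] [InnerProductSpace ℝ X]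
    [CompleteSpace X] {ι : Type*} (𝒰 : Ultrafilter ι) {h : ι → X} {C : ℝ}
    (hC : ∀ᶠ i in 𝒰, ‖h i‖ ≤ C) :
    ∃ h₀ : X, ∀ x, Tendsto (fun i ↦ ⟪h i, x⟫) 𝒰 (𝓝 ⟪h₀, x⟫) := by
  let g : ι → WeakDual ℝ X := fun i ↦ StrongDual.toWeakDual (InnerProductSpace.toDual ℝ X (h i))
  have hK := WeakDual.isCompact_closedBall (𝕜 := ℝ) (0 : StrongDual ℝ X) C
  obtain ⟨f, -, hf⟩ := hK.ultrafilter_le_nhds (𝒰.map g) <| by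
    rw [Ultrafilter.coe_map, le_principal_iff, mem_map]
    filter_upwards [hC] with i hi
    simpa [g] using hi
  refine ⟨(InnerProductSpace.toDual ℝ X).symm (WeakDual.toStrongDual f), fun x ↦ ?_⟩
  have h1 : Tendsto g 𝒰 (𝓝 f) := hf
  have h2 := ((WeakDual.eval_continuous x).tendsto f).comp h1
  simpa [g, Function.comp_def] using h2

/-- A compact operator maps bounded weakly convergent families to convergent ones. -/
theorem IsCompactOperator.tendsto_of_tendsto_inner {X : Type*} [NormedAddCommGroup X]
    [InnerProductSpace ℝ X] {K : X →L[ℝ] X} (hK : IsCompactOperator K)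
    (hsymm : ∀ x y, ⟪K x, y⟫ = ⟪x, K y⟫) {ι : Type*} (𝒰 : Ultrafilter ι) {h : ι → X} {C : ℝ}
    (hC : ∀ᶠ i in 𝒰, ‖h i‖ ≤ C) {h₀ : X} (hh : ∀ x, Tendsto (fun i ↦ ⟪h i, x⟫) 𝒰 (𝓝 ⟪h₀, x⟫)) :
    Tendsto (fun i ↦ K (h i)) 𝒰 (𝓝 (K h₀)) := by
  obtain ⟨Q, hQ, hsub⟩ := hK.image_closedBall_subset_compact (f := K.toLinearMap) C
  obtain ⟨z, -, hz⟩ := hQ.ultrafilter_le_nhds (𝒰.map fun i ↦ K (h i)) <| by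
    rw [Ultrafilter.coe_map, le_principal_iff, mem_map]
    filter_upwards [hC] with i hi
    exact hsub ⟨h i, by simpa using hi, rfl⟩
  have hz : Tendsto (fun i ↦ K (h i)) 𝒰 (𝓝 z) := hz
  suffices z = K h₀ by rwa [← this]
  refine ext_inner_right ℝ fun x ↦ ?_
  refine tendsto_nhds_unique (hz.inner tendsto_const_nhds) ?_
  simpa [hsymm] using hh (K x)

variable {X : Type*} [NormedAddCommGroup X] [InnerProductSpace ℝ X] [CompleteSpace X]
  [TopologicalSpace.SeparableSpace X] [MeasurableSpace X] [BorelSpace X]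
  {μ : Measure X} [IsGaussian μ]

/-- K is a Bochner average of rank-one operators, and the compact operators form a closed convex
set. -/
theorem isCompactOperator_covarianceOperator (μ : Measure X) [IsGaussian μ] :
    IsCompactOperator (covarianceOperator μ) := by
  have : SecondCountableTopology X := UniformSpace.secondCountable_of_separable X
  have hcont : Continuous fun x : X ↦ InnerProductSpace.rankOne ℝ x x :=
    (InnerProductSpace.rankOne ℝ (E := X) (F := X)).continuous.clm_apply continuous_id
  have hint : Integrable (fun x : X ↦ InnerProductSpace.rankOne ℝ x x) μ := by
    refine (IsGaussian.memLp_two_id (μ := μ)).integrable_norm_pow (by norm_num) |>.mono'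
      hcont.aestronglyMeasurable (ae_of_all _ fun x ↦ ?_)
    simp [sq]
  have heq : covarianceOperator μ = ∫ x, InnerProductSpace.rankOne ℝ x x ∂μ := by
    ext a
    rw [covarianceOperator_apply IsGaussian.memLp_two_id, ContinuousLinearMap.integral_apply hint]
    simp [real_inner_comm]
  have hclosed : IsClosed (compactOperator (RingHom.id ℝ) X X : Set (X →L[ℝ] X)) :=
    isClosed_setOfPred_isCompactOperator
  rw [heq]
  exact (compactOperator (RingHom.id ℝ) X X).convex.integral_mem hclosed (ae_of_all _ fun x ↦
    (isCompactOperator_of_locallyCompactSpace_rng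
      (ContinuousLinearMap.toSpanSingleton ℝ x)).comp_clm (innerSL ℝ x)) hint

/-! ### Anderson's inequality -/

/-- The coordinate along the eigenvector e is independent of the rest, and by Pythagoras each
section of the ball is an interval centered at t; the inequality on the line applies to each
section. -/
theorem measure_closedBall_add_smul_le (hμ : ∫ x, x ∂μ = 0) {e z : X} {c : ℝ} (he : ‖e‖ = 1)
    (hK : covarianceOperator μ e = c • e) (hz : ⟪e, z⟫ = 0) (t r : ℝ) :
    μ (Metric.closedBall (z + t • e) r) ≤ μ (Metric.closedBall z r) := by
  rcases lt_or_ge r 0 with hr | hr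
  · simp [Metric.closedBall_eq_empty.2 hr]
  have hee : ⟪e, e⟫ = 1 := by rw [real_inner_self_eq_norm_sq, he, one_pow]
  have key : ∀ t : ℝ, μ (Metric.closedBall (z + t • e) r) = ∫⁻ x,
      gaussianReal 0 ⟪covarianceOperator μ e, e⟫.toNNReal
        {s | (s - t) ^ 2 ≤ r ^ 2 - ‖x - ⟪e, x⟫ • e - z‖ ^ 2} ∂μ := fun t ↦ by
    have hB := (Metric.isClosed_closedBall (x := z + t • e) (ε := r)).measurableSet
    rw [← lintegral_indicator_one hB,
      lintegral_eq_lintegral_prod hμ hee hK (measurable_one.indicator hB)]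
    refine lintegral_congr fun x ↦ ?_
    rw [← lintegral_indicator_one (measurableSet_le (by fun_prop) (by fun_prop))]
    refine lintegral_congr fun s ↦ ?_
    simp only [Set.indicator, Metric.mem_closedBall, dist_eq_norm, Set.mem_ofPred_eq]
    have h1 : s • e + (x - ⟪e, x⟫ • e) - (z + t • e) = (s - t) • e + (x - ⟪e, x⟫ • e - z) := by
      rw [sub_smul]; abel
    have h2 : ⟪(s - t) • e, x - ⟪e, x⟫ • e - z⟫ = 0 := by
      rw [real_inner_smul_left, inner_sub_right, inner_sub_right, real_inner_smul_right, hee, hz]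
      ring
    have h3 : ‖s • e + (x - ⟪e, x⟫ • e) - (z + t • e)‖ ≤ r ↔
        (s - t) ^ 2 ≤ r ^ 2 - ‖x - ⟪e, x⟫ • e - z‖ ^ 2 := by
      rw [← sq_le_sq₀ (norm_nonneg _) hr, h1, sq, norm_add_sq_eq_norm_sq_add_norm_sq_real h2,
        norm_smul, he, mul_one, Real.norm_eq_abs, abs_mul_abs_self, ← sq, ← sq, le_sub_iff_add_le]
    simp only [h3, Pi.one_apply]
  have h0 := key 0
  rw [zero_smul, add_zero] at h0
  rw [key, h0]
  refine lintegral_mono fun x ↦ ?_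
  simpa using gaussianReal_zero_translate_le _ t _

theorem measure_closedBall_add_le_of_mem_eigenspace (hμ : ∫ x, x ∂μ = 0) {w z : X} {c : ℝ}
    (hK : covarianceOperator μ w = c • w) (hz : ⟪w, z⟫ = 0) (r : ℝ) :
    μ (Metric.closedBall (z + w) r) ≤ μ (Metric.closedBall z r) := by
  rcases eq_or_ne w 0 with rfl | hw
  · simp
  have hn : ‖w‖ ≠ 0 := norm_ne_zero_iff.2 hw
  have := measure_closedBall_add_smul_le hμ (e := ‖w‖⁻¹ • w) (z := z) (c := c)
    (by rw [norm_smul, norm_inv, norm_norm, inv_mul_cancel₀ hn])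
    (by rw [map_smul, hK, smul_comm]) (by rw [real_inner_smul_left, hz, mul_zero]) ‖w‖ r
  rwa [smul_smul, mul_inv_cancel₀ hn, one_smul] at this

theorem measure_closedBall_le_of_mem_iSup_eigenspace (hμ : ∫ x, x ∂μ = 0) {v : X}
    (hv : v ∈ ⨆ c : ℝ, Module.End.eigenspace (covarianceOperator μ : Module.End ℝ X) c) (r : ℝ) :
    μ (Metric.closedBall v r) ≤ μ (Metric.closedBall 0 r) := by
  classical
  -- The mutually orthogonal eigencomponents are removed one at a time.
  obtain ⟨f, hf, rfl⟩ := (Submodule.mem_iSup_iff_exists_finsupp _ _).1 hv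
  have horth := (covarianceOperator_isPositive μ).isSymmetric.orthogonalFamily_eigenspaces
  change μ (Metric.closedBall (∑ i ∈ f.support, f i) r) ≤ _
  induction f.support using Finset.induction_on with
  | empty => simp
  | insert c s hc ih =>
    rw [Finset.sum_insert hc, add_comm]
    refine (measure_closedBall_add_le_of_mem_eigenspace hμ (c := c)
      (Module.End.mem_eigenspace_iff.1 (hf c)) ?_ r).trans ih
    rw [inner_sum]
    refine Finset.sum_eq_zero fun d hd ↦ ?_
    exact horth (fun h : c = d ↦ hc (h ▸ hd)) ⟨f c, hf c⟩ ⟨f d, hf d⟩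

/-- **Anderson's inequality** for closed balls and a centered Gaussian measure. -/
theorem measure_closedBall_le_measure_closedBall_zero (hμ : ∫ x, x ∂μ = 0) (v : X) (r : ℝ) :
    μ (Metric.closedBall v r) ≤ μ (Metric.closedBall 0 r) := by
  have hdense : Dense ((⨆ c : ℝ, Module.End.eigenspace
      (covarianceOperator μ : Module.End ℝ X) c : Submodule ℝ X) : Set X) := by
    rw [Submodule.dense_iff_topologicalClosure_eq_top, Submodule.topologicalClosure_eq_top_iff]
    exact ContinuousLinearMap.orthogonalComplement_iSup_eigenspaces_eq_bot
      (isCompactOperator_covarianceOperator μ) (covarianceOperator_isPositive μ).isSymmetric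
  have hlim := tendsto_measure_biInter_gt (μ := μ) (a := r) (s := fun q ↦ Metric.closedBall (0 : X) q)
    (fun q _ ↦ Metric.isClosed_closedBall.nullMeasurableSet)
    (fun p q _ hpq ↦ Metric.closedBall_subset_closedBall hpq) ⟨r + 1, by simp, measure_ne_top _ _⟩
  have hset : ⋂ q > r, Metric.closedBall (0 : X) q = Metric.closedBall 0 r := by
    ext x
    simp only [Set.mem_iInter, Metric.mem_closedBall]
    exact ⟨fun h ↦ le_of_forall_gt_imp_ge_of_dense h, fun h q hq ↦ h.trans hq.le⟩
  rw [hset] at hlim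
  refine ge_of_tendsto hlim ?_
  filter_upwards [self_mem_nhdsWithin] with q (hq : r < q)
  -- The slack q - r pays for replacing v by a finite sum of eigenvectors.
  obtain ⟨v', hv', hd⟩ := hdense.exists_dist_lt v (sub_pos.2 hq)
  refine (measure_mono fun x hx ↦ ?_).trans (measure_closedBall_le_of_mem_iSup_eigenspace hμ hv' q)
  have := dist_triangle x v v'
  rw [Metric.mem_closedBall] at hx ⊢
  linarith

omit [InnerProductSpace ℝ X] [CompleteSpace X] [TopologicalSpace.SeparableSpace X] [BorelSpace X]
  [IsGaussian μ] in
theorem measure_ball_le_of_forall_closedBall_le {v : X} {r : ℝ} {C : ℝ≥0∞}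
    (h : ∀ q < r, μ (Metric.closedBall v q) ≤ C) : μ (Metric.ball v r) ≤ C := by
  obtain ⟨q, hmono, hlt, hlim⟩ := exists_seq_strictMono_tendsto r
  have hU : Metric.ball v r = ⋃ n, Metric.closedBall v (q n) := by
    ext x
    simp only [Metric.mem_ball, Set.mem_iUnion, Metric.mem_closedBall]
    refine ⟨fun hx ↦ ?_, fun ⟨n, hn⟩ ↦ hn.trans_lt (hlt n)⟩
    obtain ⟨n, hn⟩ := (hlim.eventually (lt_mem_nhds hx)).exists
    exact ⟨n, hn.le⟩
  rw [hU, Monotone.measure_iUnion fun m n hmn ↦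
    Metric.closedBall_subset_closedBall (hmono.monotone hmn)]
  exact iSup_le fun n ↦ h _ (hlt n)

theorem measure_ball_le_measure_ball_zero (hμ : ∫ x, x ∂μ = 0) (v : X) (r : ℝ) :
    μ (Metric.ball v r) ≤ μ (Metric.ball 0 r) :=
  measure_ball_le_of_forall_closedBall_le fun q hq ↦
    (measure_closedBall_le_measure_closedBall_zero hμ v q).trans
      (measure_mono (Metric.closedBall_subset_ball hq))

/-- Otherwise Anderson's inequality makes all balls of radius r null, and countably many of them
cover X. -/
theorem measure_ball_zero_pos (hμ : ∫ x, x ∂μ = 0) {r : ℝ} (hr : 0 < r) :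
    0 < μ (Metric.ball 0 r) := by
  rw [pos_iff_ne_zero]
  intro h0
  have hz : ∀ v, μ (Metric.ball v r) = 0 := fun v ↦
    le_antisymm ((measure_ball_le_measure_ball_zero hμ v r).trans_eq h0) bot_le
  obtain ⟨s, hs, hd⟩ := TopologicalSpace.exists_countable_dense X
  have hcover : (Set.univ : Set X) ⊆ ⋃ v ∈ s, Metric.ball v r := fun x _ ↦ by
    obtain ⟨v, hv, hxv⟩ := hd.exists_dist_lt x hr
    exact Set.mem_biUnion hv hxv
  have h1 : μ Set.univ ≤ 0 := (measure_mono hcover).trans <| by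
    rw [nonpos_iff_eq_zero, measure_biUnion_null_iff hs]
    exact fun v _ ↦ hz v
  simp at h1

/-! ### Small balls and the Cameron-Martin space -/

theorem measure_ball_le_exp_mul_ball_zero (hμ : ∫ x, x ∂μ = 0) (u a : X) (r : ℝ) :
    μ (Metric.ball u r) ≤
      ENNReal.ofReal (Real.exp (⟪covarianceOperator μ a, a⟫ / 2 - ⟪a, u⟫ + ‖a‖ * r)) *
        μ (Metric.ball 0 r) :=
  (measure_ball_le_exp_mul_ball_sub hμ u a r).trans <|
    mul_le_mul_right (measure_ball_le_measure_ball_zero hμ _ r) _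

omit [TopologicalSpace.SeparableSpace X] in
theorem posSqrt_covarianceOperator_apply_apply (μ : Measure X) (x : X) :
    posSqrt (covarianceOperator μ) (posSqrt (covarianceOperator μ) x) = covarianceOperator μ x :=
  congr($((posSqrt_spec (covarianceOperator_isPositive μ)).2) x)

omit [TopologicalSpace.SeparableSpace X] in
theorem inner_posSqrt_covarianceOperator (μ : Measure X) (x y : X) :
    ⟪posSqrt (covarianceOperator μ) x, y⟫ = ⟪x, posSqrt (covarianceOperator μ) y⟫ :=
  (posSqrt_spec (covarianceOperator_isPositive μ)).1.inner_left_eq_inner_right x y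

omit [TopologicalSpace.SeparableSpace X] in
theorem norm_sq_posSqrt_covarianceOperator (μ : Measure X) (x : X) :
    ‖posSqrt (covarianceOperator μ) x‖ ^ 2 = ⟪covarianceOperator μ x, x⟫ := by
  rw [← real_inner_self_eq_norm_sq, ← inner_posSqrt_covarianceOperator,
    posSqrt_covarianceOperator_apply_apply]

/-- The orthogonal complement of ker S is the closure of the range of S, so h is a limit of points S
a and S h of points K a. Radii q < r absorb the error, and then q ↑ r. -/
theorem exp_mul_measure_ball_zero_le_ball_posSqrt (hμ : ∫ x, x ∂μ = 0) {h : X}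
    (hh : h ∈ (posSqrt (covarianceOperator μ)).toLinearMap.kerᗮ) (r : ℝ) :
    ENNReal.ofReal (Real.exp (-(‖h‖ ^ 2 / 2))) * μ (Metric.ball 0 r) ≤
      μ (Metric.ball (posSqrt (covarianceOperator μ) h) r) := by
  set S := posSqrt (covarianceOperator μ) with hS
  have hsa : ContinuousLinearMap.adjoint S = S :=
    (posSqrt_spec (covarianceOperator_isPositive μ)).1.isSelfAdjoint.adjoint_eq
  have hcl : h ∈ closure (Set.range S) := by
    have := S.orthogonal_ker
    rw [hsa] at this
    rw [this] at hh
    exact hh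
  obtain ⟨y, hy, hlim⟩ := mem_closure_iff_seq_limit.1 hcl
  choose a ha using hy
  have hq : ∀ q < r, ENNReal.ofReal (Real.exp (-(‖h‖ ^ 2 / 2))) * μ (Metric.ball 0 q) ≤
      μ (Metric.ball (S h) r) := by
    intro q hq
    have hl : Tendsto (fun n ↦ ENNReal.ofReal (Real.exp (-(‖y n‖ ^ 2 / 2))) *
        μ (Metric.ball (0 : X) q)) atTop
        (𝓝 (ENNReal.ofReal (Real.exp (-(‖h‖ ^ 2 / 2))) * μ (Metric.ball 0 q))) := by
      refine ENNReal.Tendsto.mul_const (ENNReal.tendsto_ofReal ?_) (Or.inr (measure_ne_top _ _))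
      exact (Real.continuous_exp.tendsto _).comp (((hlim.norm.pow 2).div_const 2).neg)
    refine le_of_tendsto hl ?_
    have hd : ∀ᶠ n in atTop, dist (S (y n)) (S h) < r - q :=
      ((S.continuous.tendsto h).comp hlim).eventually
        (Metric.ball_mem_nhds _ (sub_pos.2 hq))
    filter_upwards [hd] with n hn
    have h1 := exp_mul_measure_ball_zero_le hμ (a n) q
    rw [← norm_sq_posSqrt_covarianceOperator, ← posSqrt_covarianceOperator_apply_apply, ← hS,
      ha] at h1
    refine h1.trans (measure_mono (Metric.ball_subset_ball' ?_))
    linarith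
  rw [mul_comm, ← ENNReal.le_div_iff_mul_le (Or.inl (by simp [Real.exp_pos]))
    (Or.inl ENNReal.ofReal_ne_top)]
  refine measure_ball_le_of_forall_closedBall_le fun q hqr ↦ ?_
  obtain ⟨p, hqp, hpr⟩ := exists_between hqr
  rw [ENNReal.le_div_iff_mul_le (Or.inl (by simp [Real.exp_pos])) (Or.inl ENNReal.ofReal_ne_top),
    mul_comm]
  refine (mul_le_mul_right (measure_mono ?_) _).trans (hq p hpr)
  exact Metric.closedBall_subset_ball hqp

/-- Tikhonov regularization: a = (K + r)⁻¹ u is inserted into the upper bound for balls, and 2‖a‖ ≤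
‖a‖² + 1 absorbs the error ‖a‖ r. -/
theorem exists_eq_covarianceOperator_add_smul (hμ : ∫ x, x ∂μ = 0) {u : X} {r κ : ℝ} (hr : 0 < r)
    (h : ENNReal.ofReal (Real.exp (-(κ / 2))) * μ (Metric.ball 0 r) ≤ μ (Metric.ball u r)) :
    ∃ a, u = covarianceOperator μ a + r • a ∧
      ⟪covarianceOperator μ a, a⟫ + r * ‖a‖ ^ 2 ≤ κ + r := by
  set K := covarianceOperator μ with hKdef
  have hunit : IsUnit (K + r • (1 : X →L[ℝ] X)) := by
    refine ContinuousLinearMap.isUnit_of_forall_le_norm_inner_map _ (c := ⟨r, hr.le⟩) hr fun x ↦ ?_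
    refine le_trans ?_ (le_abs_self _)
    have := (covarianceOperator_isPositive μ).inner_nonneg_left x
    simp only [add_apply, smul_apply, one_apply_eq_self, inner_add_left, real_inner_smul_left,
      real_inner_self_eq_norm_sq]
    change ‖x‖ ^ 2 * r ≤ _
    rw [← hKdef] at this
    linarith
  rw [ContinuousLinearMap.isUnit_iff_bijective] at hunit
  obtain ⟨a, ha⟩ := hunit.2 u
  have ha : u = K a + r • a := by simpa using ha.symm
  refine ⟨a, ha, ?_⟩
  have h1 := h.trans (measure_ball_le_exp_mul_ball_zero hμ u a r)
  rw [ENNReal.mul_le_mul_iff_left (measure_ball_zero_pos hμ hr).ne' (measure_ne_top _ _),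
    ENNReal.ofReal_le_ofReal_iff (Real.exp_nonneg _), Real.exp_le_exp, ha, inner_add_right,
    real_inner_smul_right, real_inner_self_eq_norm_sq, real_inner_comm] at h1
  rw [← hKdef, real_inner_comm] at h1
  nlinarith [mul_nonneg hr.le (sq_nonneg (‖a‖ - 1))]

/-- Points whose small balls have comparable mass to the balls at the origin accumulate, as the
radius tends to zero, at points of the Cameron-Martin space of controlled norm. -/
theorem exists_tendsto_posSqrt_of_eventually_le (hμ : ∫ x, x ∂μ = 0) (𝒰 : Ultrafilter ℝ)
    (h𝒰 : (𝒰 : Filter ℝ) ≤ 𝓝[>] 0) {u : ℝ → X} {κ : ℝ}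
    (h : ∀ᶠ r in 𝒰, ENNReal.ofReal (Real.exp (-(κ / 2))) * μ (Metric.ball 0 r) ≤
      μ (Metric.ball (u r) r)) :
    ∃ h₀, ‖h₀‖ ^ 2 ≤ κ ∧ Tendsto u 𝒰 (𝓝 (posSqrt (covarianceOperator μ) h₀)) := by
  set S := posSqrt (covarianceOperator μ) with hS
  have hr0 : Tendsto (fun r : ℝ ↦ r) 𝒰 (𝓝 0) := h𝒰.trans nhdsWithin_le_nhds
  have hpos : ∀ᶠ r : ℝ in 𝒰, 0 < r := h𝒰 self_mem_nhdsWithin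
  have hex : ∀ r : ℝ, ∃ a, (0 < r ∧ ENNReal.ofReal (Real.exp (-(κ / 2))) * μ (Metric.ball 0 r) ≤
      μ (Metric.ball (u r) r)) → u r = S (S a) + r • a ∧ ‖S a‖ ^ 2 + r * ‖a‖ ^ 2 ≤ κ + r := by
    intro r
    by_cases hr : 0 < r ∧ ENNReal.ofReal (Real.exp (-(κ / 2))) * μ (Metric.ball 0 r) ≤
      μ (Metric.ball (u r) r)
    · obtain ⟨a, ha⟩ := exists_eq_covarianceOperator_add_smul hμ hr.1 hr.2
      rw [← posSqrt_covarianceOperator_apply_apply, ← hS, inner_posSqrt_covarianceOperator, ← hS,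
        real_inner_self_eq_norm_sq] at ha
      exact ⟨a, fun _ ↦ ha⟩
    · exact ⟨0, fun h ↦ absurd h hr⟩
  choose a ha using hex
  have ha : ∀ᶠ r in 𝒰, u r = S (S (a r)) + r • a r ∧ ‖S (a r)‖ ^ 2 + r * ‖a r‖ ^ 2 ≤ κ + r := by
    filter_upwards [hpos, h] with r h1 h2 using ha r ⟨h1, h2⟩
  have hbound : ∀ᶠ r in 𝒰, ‖S (a r)‖ ≤ √(κ + r) := by
    filter_upwards [ha, hpos] with r hr h0
    refine Real.le_sqrt_of_sq_le ?_
    nlinarith [hr.2, sq_nonneg ‖a r‖]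
  have hlimκ : Tendsto (fun r ↦ κ + r) 𝒰 (𝓝 κ) := by simpa using hr0.const_add κ
  have hκ : 0 ≤ κ := by
    refine ge_of_tendsto hlimκ ?_
    filter_upwards [ha, hpos] with r hr h0
    nlinarith [hr.2, sq_nonneg ‖a r‖, sq_nonneg ‖S (a r)‖]
  have hbound' : ∀ᶠ r in 𝒰, ‖S (a r)‖ ≤ √(κ + 1) := by
    filter_upwards [hbound, hr0.eventually (gt_mem_nhds zero_lt_one)] with r h1 h2
    exact h1.trans (Real.sqrt_le_sqrt (by linarith))
  -- h₀ is the weak limit of S a_r; the norm bound follows by testing against h₀ itself.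
  obtain ⟨h₀, hh₀⟩ := exists_tendsto_inner_of_norm_le 𝒰 hbound'
  have hn : ‖h₀‖ ≤ √κ := by
    have h1 : ‖h₀‖ * ‖h₀‖ ≤ √κ * ‖h₀‖ := by
      rw [← real_inner_self_eq_norm_mul_norm]
      refine le_of_tendsto_of_tendsto (hh₀ h₀) (hlimκ.sqrt.mul_const ‖h₀‖) ?_
      filter_upwards [hbound] with r hr
      exact (real_inner_le_norm _ _).trans (mul_le_mul_of_nonneg_right hr (norm_nonneg _))
    rcases (norm_nonneg h₀).eq_or_lt with h2 | h2
    · rw [← h2]; exact Real.sqrt_nonneg _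
    · exact le_of_mul_le_mul_right h1 h2
  refine ⟨h₀, by simpa [Real.sq_sqrt hκ] using pow_le_pow_left₀ (norm_nonneg _) hn 2, ?_⟩
  have hK := (isCompactOperator_covarianceOperator μ).tendsto_of_tendsto_inner
    (covarianceOperator_isPositive μ).inner_left_eq_inner_right 𝒰 hbound' hh₀
  -- Compactness of K suffices, since ‖S x‖² = ⟪K x, x⟫ ≤ ‖K x‖ ‖x‖.
  have hSconv : Tendsto (fun r ↦ S (S (a r))) 𝒰 (𝓝 (S h₀)) := by
    rw [tendsto_iff_norm_sub_tendsto_zero]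
    have h1 : Tendsto (fun r ↦ √(‖covarianceOperator μ (S (a r)) - covarianceOperator μ h₀‖ *
        (√(κ + 1) + ‖h₀‖))) 𝒰 (𝓝 0) := by
      have := ((tendsto_iff_norm_sub_tendsto_zero.1 hK).mul_const (√(κ + 1) + ‖h₀‖)).sqrt
      simpa using this
    refine tendsto_of_tendsto_of_tendsto_of_le_of_le' tendsto_const_nhds h1
      (Eventually.of_forall fun _ ↦ norm_nonneg _) ?_
    filter_upwards [hbound'] with r hr
    refine Real.le_sqrt_of_sq_le ?_
    rw [← map_sub, norm_sq_posSqrt_covarianceOperator, ← map_sub]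
    refine (real_inner_le_norm _ _).trans (mul_le_mul_of_nonneg_left ?_ (norm_nonneg _))
    exact (norm_sub_le _ _).trans (by linarith)
  have hsmall : Tendsto (fun r ↦ r • a r) 𝒰 (𝓝 0) := by
    rw [tendsto_zero_iff_norm_tendsto_zero]
    have h1 : Tendsto (fun r ↦ √(r * (κ + r))) 𝒰 (𝓝 0) := by
      simpa using (hr0.mul hlimκ).sqrt
    refine tendsto_of_tendsto_of_tendsto_of_le_of_le' tendsto_const_nhds h1
      (Eventually.of_forall fun _ ↦ norm_nonneg _) ?_
    filter_upwards [ha, hpos] with r hr h0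
    refine Real.le_sqrt_of_sq_le ?_
    rw [norm_smul, Real.norm_of_nonneg h0.le]
    have : r * ‖a r‖ ^ 2 ≤ κ + r := by nlinarith [hr.2, sq_nonneg ‖S (a r)‖]
    nlinarith
  have := hSconv.add hsmall
  rw [add_zero] at this
  refine this.congr' ?_
  filter_upwards [ha] with r hr using hr.1.symm

/-! ### The Cameron-Martin norm -/

omit [TopologicalSpace.SeparableSpace X] in
theorem cameronMartinNorm_posSqrt_le (μ : Measure X) (h : X) :
    cameronMartinNorm μ (posSqrt (covarianceOperator μ) h) ≤ ‖h‖ₑ := by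
  set S := posSqrt (covarianceOperator μ) with hS
  have : CompleteSpace S.toLinearMap.ker := S.isClosed_ker.completeSpace_coe
  -- Removing the kernel component of h keeps S h and does not increase the norm.
  set p := S.toLinearMap.ker.starProjection h
  have hp : p ∈ S.toLinearMap.ker := S.toLinearMap.ker.starProjection_apply_mem h
  have ho : h - p ∈ S.toLinearMap.kerᗮ := S.toLinearMap.ker.sub_starProjection_mem_orthogonal h
  have hSp : S (h - p) = S h := by
    have : S p = 0 := hp
    rw [map_sub, this, sub_zero]
  refine (iInf₂_le_of_le (h - p) ho (iInf_le _ hSp)).trans ?_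
  rw [enorm_le_iff_norm_le, ← sq_le_sq₀ (norm_nonneg _) (norm_nonneg _)]
  have := norm_add_sq_eq_norm_sq_add_norm_sq_real (Submodule.inner_left_of_mem_orthogonal hp ho)
  rw [sub_add_cancel] at this
  nlinarith [mul_self_nonneg ‖p‖]

omit [TopologicalSpace.SeparableSpace X] in
theorem cameronMartinNorm_posSqrt (μ : Measure X) {h : X}
    (hh : h ∈ (posSqrt (covarianceOperator μ)).toLinearMap.kerᗮ) :
    cameronMartinNorm μ (posSqrt (covarianceOperator μ) h) = ‖h‖ₑ := by
  refine le_antisymm (cameronMartinNorm_posSqrt_le μ h) ?_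
  refine le_iInf₂ fun v hv ↦ le_iInf fun hSv ↦ ?_
  have h1 : h - v ∈ (posSqrt (covarianceOperator μ)).toLinearMap.ker := by
    simp [hSv]
  have h2 := Submodule.inner_right_of_mem_orthogonal h1 (Submodule.sub_mem _ hh hv)
  rw [inner_self_eq_zero, sub_eq_zero] at h2
  rw [h2]

omit [TopologicalSpace.SeparableSpace X] [IsGaussian μ] in
theorem exists_posSqrt_eq_of_cameronMartinNorm_lt {u : X} {b : ℝ≥0∞}
    (h : cameronMartinNorm μ u < b) :
    ∃ v ∈ (posSqrt (covarianceOperator μ)).toLinearMap.kerᗮ,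
      posSqrt (covarianceOperator μ) v = u ∧ ‖v‖ₑ < b := by
  simp only [cameronMartinNorm, iInf_lt_iff] at h
  obtain ⟨v, hv, hSv, hb⟩ := h
  exact ⟨v, hv, hSv, hb⟩

end

/-! ### Modes and minimizers -/

section

open scoped RealInnerProductSpace NNReal ENNReal Topology
open Filter

variable {X Y : Type*} [NormedAddCommGroup X] [InnerProductSpace ℝ X] [CompleteSpace X]
  [TopologicalSpace.SeparableSpace X] [MeasurableSpace X] [BorelSpace X]
  {μ : Measure X} [IsGaussian μ]

theorem cameronMartinNorm_le_of_isConditionalMode (hμ : ∫ x, x ∂μ = 0) {T : X → Y} {y : Y}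
    {u v : X} (hu : IsConditionalMode μ T y u) (hv : v ∈ T ⁻¹' {y}) :
    cameronMartinNorm μ u ≤ cameronMartinNorm μ v := by
  refine le_of_forall_gt fun b hb ↦ ?_
  obtain ⟨h, hh, rfl, hhb⟩ := exists_posSqrt_eq_of_cameronMartinNorm_lt hb
  -- The gap between ‖h‖ and b' leaves room for a ratio that is only close to 1.
  obtain ⟨b', hb'0, hhb', hb'b⟩ := ENNReal.lt_iff_exists_real_btwn.1 hhb
  have hlt : ‖h‖ < b' := by
    rwa [← ofReal_norm, ENNReal.ofReal_lt_ofReal_iff_of_nonneg (norm_nonneg _)] at hhb'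
  have hδ : ENNReal.ofReal (Real.exp ((‖h‖ ^ 2 - b' ^ 2) / 2)) < 1 := by
    rw [ENNReal.ofReal_lt_one, Real.exp_lt_one_iff]
    nlinarith [norm_nonneg h]
  have hev : ∀ᶠ r in 𝓝[>] (0 : ℝ), ENNReal.ofReal (Real.exp (-(b' ^ 2 / 2))) *
      μ (Metric.ball 0 r) ≤ μ (Metric.ball u r) := by
    filter_upwards [hu.2.eventually (lt_mem_nhds hδ)] with r hr
    have h1 := ENNReal.mul_le_of_le_div hr.le
    refine le_trans ?_ h1
    have h2 := (exp_mul_measure_ball_zero_le_ball_posSqrt hμ hh r).trans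
      (le_iSup₂ (f := fun w (_ : w ∈ T ⁻¹' {y}) ↦ μ (Metric.ball w r)) _ hv)
    refine le_trans (le_of_eq ?_) (mul_le_mul_right h2 _)
    rw [← mul_assoc, ← ENNReal.ofReal_mul (Real.exp_nonneg _), ← Real.exp_add]
    congr 3
    ring
  have hle := Ultrafilter.of_le (𝓝[>] (0 : ℝ))
  obtain ⟨h₀, hh₀, hlim⟩ := exists_tendsto_posSqrt_of_eventually_le hμ
    (Ultrafilter.of (𝓝[>] (0 : ℝ))) hle (u := fun _ ↦ u) (hle hev)
  have hu0 : u = posSqrt (covarianceOperator μ) h₀ := tendsto_nhds_unique tendsto_const_nhds hlim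
  calc cameronMartinNorm μ u ≤ ‖h₀‖ₑ := hu0 ▸ cameronMartinNorm_posSqrt_le μ h₀
    _ ≤ ENNReal.ofReal b' := by
      rw [← ofReal_norm]
      exact ENNReal.ofReal_le_ofReal ((le_abs_self _).trans (abs_le_of_sq_le_sq hh₀ hb'0))
    _ < b := hb'b

theorem isConditionalMode_of_forall_cameronMartinNorm_le [TopologicalSpace Y] [T1Space Y]
    (hμ : ∫ x, x ∂μ = 0) {T : X → Y} (hT : Continuous T) {y : Y} {u : X} (hu : u ∈ T ⁻¹' {y})
    (hfin : cameronMartinNorm μ u < ∞)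
    (hmin : ∀ v ∈ T ⁻¹' {y}, cameronMartinNorm μ u ≤ cameronMartinNorm μ v) :
    IsConditionalMode μ T y u := by
  obtain ⟨h, hh, rfl, -⟩ := exists_posSqrt_eq_of_cameronMartinNorm_lt hfin
  rw [cameronMartinNorm_posSqrt μ hh] at hmin
  set S := posSqrt (covarianceOperator μ) with hS
  refine ⟨hu, tendsto_order.2 ⟨fun δ hδ ↦ ?_, fun b hb ↦ Eventually.of_forall fun r ↦ ?_⟩⟩
  · by_contra hcon
    obtain ⟨ρ, hρ0, hδρ, hρ1⟩ := ENNReal.lt_iff_exists_real_btwn.1 hδ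
    have hρ1 : ρ < 1 := ENNReal.ofReal_lt_one.1 hρ1
    have hρ0 : 0 < ρ := ENNReal.ofReal_pos.1 (bot_le.trans_lt hδρ)
    -- The ultrafilter below is concentrated on the radii with ratio at most δ.
    rw [not_eventually, frequently_iff_neBot] at hcon
    set 𝒰 := Ultrafilter.of (𝓝[>] (0 : ℝ) ⊓ 𝓟 {r | ¬ δ < μ (Metric.ball (S h) r) /
      ⨆ v ∈ T ⁻¹' {y}, μ (Metric.ball v r)})
    have hle := Ultrafilter.of_le (𝓝[>] (0 : ℝ) ⊓ 𝓟 {r | ¬ δ < μ (Metric.ball (S h) r) /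
      ⨆ v ∈ T ⁻¹' {y}, μ (Metric.ball v r)})
    have h𝒰 : (𝒰 : Filter ℝ) ≤ 𝓝[>] 0 := hle.trans inf_le_left
    have hbad : ∀ᶠ r in 𝒰, ¬ δ < μ (Metric.ball (S h) r) /
        ⨆ v ∈ T ⁻¹' {y}, μ (Metric.ball v r) := le_principal_iff.1 (hle.trans inf_le_right)
    -- A feasible center beats S h by the factor 1/ρ, so κ = ‖h‖² + 2 log ρ, strictly below ‖h‖²
    -- because ρ < 1.
    have hex : ∀ᶠ r in 𝒰, ∃ v ∈ T ⁻¹' {y},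
        ENNReal.ofReal (Real.exp (-((‖h‖ ^ 2 + 2 * Real.log ρ) / 2))) * μ (Metric.ball 0 r) ≤
          μ (Metric.ball v r) := by
      filter_upwards [hbad, h𝒰 self_mem_nhdsWithin] with r hr (hr0 : 0 < r)
      set M := ⨆ v ∈ T ⁻¹' {y}, μ (Metric.ball v r) with hM
      have hlow := exp_mul_measure_ball_zero_le_ball_posSqrt hμ hh r
      have hposS : 0 < μ (Metric.ball (S h) r) := lt_of_lt_of_le
        (ENNReal.mul_pos (by simp [Real.exp_pos]) (measure_ball_zero_pos hμ hr0).ne') hlow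
      have hMpos : 0 < M := hposS.trans_le
        (le_iSup₂ (f := fun w (_ : w ∈ T ⁻¹' {y}) ↦ μ (Metric.ball w r)) _ hu)
      have hMtop : M ≠ ∞ := ((iSup₂_le fun w _ ↦ prob_le_one).trans_lt ENNReal.one_lt_top).ne
      have h1 : μ (Metric.ball (S h) r) < ENNReal.ofReal ρ * M :=
        (ENNReal.div_lt_iff (Or.inl hMpos.ne') (Or.inl hMtop)).1 ((not_lt.1 hr).trans_lt hδρ)
      have h2 : μ (Metric.ball (S h) r) / ENNReal.ofReal ρ < M := by
        rw [ENNReal.div_lt_iff (Or.inl (by simpa using hρ0)) (Or.inl ENNReal.ofReal_ne_top),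
          mul_comm]
        exact h1
      simp only [hM, lt_iSup_iff] at h2
      obtain ⟨v, hv, h3⟩ := h2
      refine ⟨v, hv, le_trans ?_ h3.le⟩
      rw [ENNReal.le_div_iff_mul_le (Or.inl (by simpa using hρ0)) (Or.inl ENNReal.ofReal_ne_top)]
      refine le_trans (le_of_eq ?_) hlow
      rw [mul_right_comm, ← ENNReal.ofReal_mul (Real.exp_nonneg _)]
      congr 2
      nth_rewrite 2 [← Real.exp_log hρ0]
      rw [← Real.exp_add]
      congr 1
      ring
    have : ∃ w : ℝ → X, ∀ᶠ r in 𝒰, w r ∈ T ⁻¹' {y} ∧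
        ENNReal.ofReal (Real.exp (-((‖h‖ ^ 2 + 2 * Real.log ρ) / 2))) * μ (Metric.ball 0 r) ≤
          μ (Metric.ball (w r) r) := by
      classical
      refine ⟨fun r ↦ if hr : _ then Classical.choose (p := fun v ↦ v ∈ T ⁻¹' {y} ∧
        ENNReal.ofReal (Real.exp (-((‖h‖ ^ 2 + 2 * Real.log ρ) / 2))) * μ (Metric.ball 0 r) ≤
          μ (Metric.ball v r)) hr else 0, ?_⟩
      filter_upwards [hex] with r hr
      rw [dif_pos hr]
      exact Classical.choose_spec hr
    obtain ⟨w, hw⟩ := this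
    obtain ⟨h₀, hh₀, hlim⟩ := exists_tendsto_posSqrt_of_eventually_le hμ 𝒰 h𝒰
      (hw.mono fun r hr ↦ hr.2)
    have hmem : S h₀ ∈ T ⁻¹' {y} :=
      (isClosed_singleton.preimage hT).mem_of_tendsto hlim (hw.mono fun r hr ↦ hr.1)
    have hle₀ := (hmin _ hmem).trans (cameronMartinNorm_posSqrt_le μ h₀)
    rw [enorm_le_iff_norm_le] at hle₀
    have hlog := Real.log_neg hρ0 hρ1
    have := pow_le_pow_left₀ (norm_nonneg _) hle₀ 2
    linarith
  · refine lt_of_le_of_lt (ENNReal.div_le_of_le_mul ?_) hb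
    rw [one_mul]
    exact le_iSup₂ (f := fun w (_ : w ∈ T ⁻¹' {y}) ↦ μ (Metric.ball w r)) _ hu

end

theorem mainTheorem3 {X Y : Type*}
    [NormedAddCommGroup X] [InnerProductSpace ℝ X] [CompleteSpace X]
    [TopologicalSpace.SeparableSpace X] [MeasurableSpace X] [BorelSpace X]
    [NormedAddCommGroup Y] [InnerProductSpace ℝ Y] [CompleteSpace Y]
    [TopologicalSpace.SeparableSpace Y] [MeasurableSpace Y] [BorelSpace Y]
    (μ : Measure X) [IsGaussian μ] (hμ : ∫ x, x ∂μ = 0)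
    (T : X → Y) (hT : Continuous T)
    (y : Y) (hy : y ∈ T '' (cameronMartinSpace μ : Set X) ∩ (μ.map T).support)
    (u : X) :
    IsConditionalMode μ T y u ↔ SolvesConstrainedMinimization μ T y u := by
  refine ⟨fun hu ↦ ⟨hu.1, fun v hv ↦ cameronMartinNorm_le_of_isConditionalMode hμ hu hv⟩,
    fun ⟨hu, hmin⟩ ↦ isConditionalMode_of_forall_cameronMartinNorm_le hμ hT hu ?_ hmin⟩
  -- Some feasible point lies in H(μ), so the minimum is finite.
  obtain ⟨_, ⟨h, rfl⟩, hTh⟩ := hy.1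
  exact ((hmin _ hTh).trans (cameronMartinNorm_posSqrt_le μ h)).trans_lt enorm_lt_top
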